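/- **Setting.** Let $\mathcal M$ be a type $\mathrm{II}_1$ factor with normalized trace $\tau$ and operator norm $\|\cdot\|$, put $\|x\|_2=\tau(x^*x)^{1/2}$, and let $L^2(\mathcal N,\tau)$ be the $\|\cdot\|_2$-completion of a von Neumann subalgebra $\mathcal N\subseteq\mathcal M$. Write $\mathbb E_{\mathcal N}:\mathcal M\to\mathcal N$ for the trace preserving conditional expectation, i.e. $\mathbb E_{\mathcal N}(x)$ is the element of $\mathcal N$ with $\tau(\mathbb E_{\mathcal N}(x)a)=\tau(xa)$ for all $a\in\mathcal N$. For a linear map $\phi:\mathcal M\to\mathcal M$ let $\|\phi\|_{\infty,2}=\sup\{\|\phi(x)\|_2 : \|x\|\le 1\}$. **Definitions.** Let $\mathcal A\subseteq\mathcal M$ be an abelian von Neumann subalgebra. - $\mathbb E_{\mathcal A}$ is an *asymptotic homomorphism* if there is a unitary $u\in\mathcal A$ such that $\lim_{|k|\to\infty}\|\mathbb E_{\mathcal A}(xu^ky)-\mathbb E_{\mathcal A}(x)\mathbb E_{\mathcal A}(y)u^k\|_2=0$ (with $k\in\mathbb Z$) for all $x,y\in\mathcal M$. - $\mathcal A$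 is a *masa* if it is maximal among the abelian self-adjoint subalgebras of $\mathcal M$. A masa $\mathcal A$ is *strongly singular* if $\|u-\mathbb E_{\mathcal A}(u)\|_2\le\|\mathbb E_{u\mathcal Au^*}-\mathbb E_{\mathcal A}\|_{\infty,2}$ for every unitary $u\in\mathcal M$. - *Popa's invariant* $\delta(\mathcal A)$ is the largest $c\in[0,1]$ such that $$\sup\{\|x-\mathbb E_{\mathcal A}(x)\|_2 : x\in v\mathcal Av^*,\ \|x\|\le 1\}\ \ge\ c\,\|vv^*\|_2$$ for every partial isometry $v\in\mathcal M$ with $v^2=0$ and $vv^*,v^*v\in\mathcal A$. **Theorem 3.1.** Let $\mathcal A$ be an abelian von Neumann subalgebra of a type $\mathrm{II}_1$ factor $\mathcal M$, and suppose that there is a $*$-isomorphism $\pi:\mathcal A\to L^\infty[0,1]$ which induces an isometry from $L^2(\mathcal A,\tau)$ onto $L^2[0,1]$. Let $\{v_n: n\ge 0\}\subseteq\mathcal A$ be an orthonormal basis of $L^2(\mathcal A,\tau)$, and let $Y\subseteq\mathcal M$ be a set whose linear span is norm dense in $L^2(\mathcal M,\tau)$. If $$\sum_{n=0}^\infty\|\mathbb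 E_{\mathcal A}(xv_ny)-\mathbb E_{\mathcal A}(x)\,\mathbb E_{\mathcal A}(y)\,v_n\|_2^2<\infty\qquad\text{for all }x,y\in Y,$$ then $\mathbb E_{\mathcal A}$ is an asymptotic homomorphism, $\mathcal A$ is a strongly singular masa, and $\delta(\mathcal A)=1$. -/

import Mathlib

open MeasureTheory Filter Topology
open scoped ENNReal ComplexOrder

namespace VNMasa

section TracialAlgebra

variable {R : Type*} [NormedRing R] [StarRing R] [Algebra ℂ R] [StarModule ℂ R]

/-- `τ` is a normalized faithful trace. On a II₁ factor there is exactly one such functional,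
the usual normalized trace (which is then automatically normal). -/
structure IsNormalizedTrace (τ : R →ₗ[ℂ] ℂ) : Prop where
  map_one : τ 1 = 1
  map_mul_comm : ∀ x y : R, τ (x * y) = τ (y * x)
  nonneg : ∀ x : R, 0 ≤ τ (star x * x)
  faithful : ∀ x : R, τ (star x * x) = 0 → x = 0

/-- The trace norm `‖x‖₂ = τ(x* x)^{1/2}`. -/
noncomputable def l2Norm (τ : R →ₗ[ℂ] ℂ) (x : R) : ℝ := Real.sqrt (τ (star x * x)).re

/-- The linear span of `S` is `‖·‖₂`-dense in `L²(N, τ)`. As `L²(N, τ)` is the `‖·‖₂`-completion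
of `N`, this says that every element of `N` is a `‖·‖₂`-limit of elements of the span
(it is used only for `S ⊆ N`). -/
def HasL2DenseSpan (τ : R →ₗ[ℂ] ℂ) (N : StarSubalgebra ℂ R) (S : Set R) : Prop :=
  ∀ x ∈ N, ∀ ε > 0, ∃ z ∈ Submodule.span ℂ S, l2Norm τ (x - z) < ε

/-- `(v n)`, a sequence of elements of `N`, is an orthonormal basis of `L²(N, τ)`, the Hilbert
space completion of `N` for the inner product `τ(x* y)`. -/
structure IsL2OrthonormalBasis (τ : R →ₗ[ℂ] ℂ) (N : StarSubalgebra ℂ R) (v : ℕ → R) : Prop where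
  mem : ∀ n, v n ∈ N
  orthonormal : ∀ i j, τ (star (v i) * v j) = if i = j then 1 else 0
  dense : HasL2DenseSpan τ N (Set.range v)

open Classical in
/-- The trace preserving conditional expectation onto `N`: `traceCondExp τ N x` is the element
`y` of `N` with `τ(y a) = τ(x a)` for all `a ∈ N`. For a faithful trace there is at most one;
it exists when `N` is a von Neumann subalgebra of a II₁ factor. -/
noncomputable def traceCondExp (τ : R →ₗ[ℂ] ℂ) (N : StarSubalgebra ℂ R) (x : R) : R :=
  if h : ∃ y ∈ N, ∀ a ∈ N, τ (y * a) = τ (x * a) then h.choose else 0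

/-- `‖φ‖_{∞,2}`, the norm of `φ` from the operator norm to the trace norm. -/
noncomputable def normInftyTwo (τ : R →ₗ[ℂ] ℂ) (φ : R → R) : ℝ :=
  sSup {r : ℝ | ∃ x : R, ‖x‖ ≤ 1 ∧ r = l2Norm τ (φ x)}

/-- `A` is commutative. -/
def IsAbelian (A : StarSubalgebra ℂ R) : Prop := ∀ a ∈ A, ∀ b ∈ A, a * b = b * a

/-- `A` is a masa: a maximal abelian self-adjoint subalgebra. -/
def IsMasa (A : StarSubalgebra ℂ R) : Prop := Maximal IsAbelian A

/-- The conjugate `u A u*` of `A` by a unitary `u`. -/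
noncomputable def conj (u : unitary R) (A : StarSubalgebra ℂ R) : StarSubalgebra ℂ R :=
  A.map (Unitary.conjStarAlgAut ℂ R u : R →⋆ₐ[ℂ] R)

/-- `A` is a strongly singular masa: `‖u - E_A(u)‖₂ ≤ ‖E_{uAu*} - E_A‖_{∞,2}` for all
unitaries `u`. -/
def IsStronglySingularMasa (τ : R →ₗ[ℂ] ℂ) (A : StarSubalgebra ℂ R) : Prop :=
  IsMasa A ∧ ∀ u : unitary R,
    l2Norm τ ((u : R) - traceCondExp τ A (u : R)) ≤
      normInftyTwo τ (fun x => traceCondExp τ (conj u A) x - traceCondExp τ A x)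

/-- `E_A` is an asymptotic homomorphism: for some unitary `u ∈ A`,
`‖E_A(x u^k y) - E_A(x) E_A(y) u^k‖₂ → 0` as `|k| → ∞` (`k ∈ ℤ`), for all `x`, `y`. -/
def IsAsymptoticHomomorphism (τ : R →ₗ[ℂ] ℂ) (A : StarSubalgebra ℂ R) : Prop :=
  ∃ u : unitary R, (u : R) ∈ A ∧ ∀ x y : R,
    Tendsto (fun k : ℤ => l2Norm τ
      (traceCondExp τ A (x * ((u ^ k : unitary R) : R) * y)
        - traceCondExp τ A x * traceCondExp τ A y * ((u ^ k : unitary R) : R)))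
      (cofinite : Filter ℤ) (𝓝 0)

/-- `sup {‖x - E_A(x)‖₂ : x ∈ v A v*, ‖x‖ ≤ 1}`. -/
noncomputable def conjDeviation (τ : R →ₗ[ℂ] ℂ) (A : StarSubalgebra ℂ R) (v : R) : ℝ :=
  sSup {r : ℝ | ∃ a ∈ A, ‖v * a * star v‖ ≤ 1 ∧
    r = l2Norm τ (v * a * star v - traceCondExp τ A (v * a * star v))}

/-- Popa's invariant `δ(A)`: the largest `c ∈ [0,1]` such that
`sup {‖x - E_A(x)‖₂ : x ∈ v A v*, ‖x‖ ≤ 1} ≥ c ‖v v*‖₂` for every nilpotent (`v² = 0`) partial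
isometry `v` whose initial and final projections `v* v`, `v v*` lie in `A`. -/
noncomputable def popaDelta (τ : R →ₗ[ℂ] ℂ) (A : StarSubalgebra ℂ R) : ℝ :=
  sSup {c : ℝ | 0 ≤ c ∧ c ≤ 1 ∧ ∀ v : R, v * star v * v = v → v * v = 0 →
    star v * v ∈ A → v * star v ∈ A → c * l2Norm τ (v * star v) ≤ conjDeviation τ A v}

/-- `π` is a `*`-isomorphism of `A` onto `L^∞[0,1]` (Lebesgue measure, pointwise operations
almost everywhere) which preserves the `L²`-norms; it therefore extends to an isometry of
`L²(A, τ)` onto `L²[0,1]`, as `L^∞[0,1]` is dense there. -/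
structure IsL2IsometricStarIso (τ : R →ₗ[ℂ] ℂ) (A : StarSubalgebra ℂ R)
    (π : A ≃ₗ[ℂ] Lp ℂ ∞ (volume.restrict (Set.Icc (0 : ℝ) 1))) : Prop where
  map_mul : ∀ a b : A,
    ∀ᵐ t ∂(volume.restrict (Set.Icc (0 : ℝ) 1)), π (a * b) t = π a t * π b t
  map_star : ∀ a : A,
    ∀ᵐ t ∂(volume.restrict (Set.Icc (0 : ℝ) 1)), π (star a) t = star (π a t)
  isometry : ∀ a : A,
    eLpNorm (π a) 2 (volume.restrict (Set.Icc (0 : ℝ) 1)) = ENNReal.ofReal (l2Norm τ (a : R))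

end TracialAlgebra

section VonNeumann

variable {H : Type*} [NormedAddCommGroup H] [InnerProductSpace ℂ H] [CompleteSpace H]

/-- The von Neumann algebra `M` is a factor of type II₁: nonzero, with trivial centre, finite
(every isometry in `M` is unitary), and without minimal projections. -/
structure IsTypeIIOneFactor (M : VonNeumannAlgebra H) : Prop where
  nonzero : (1 : M.toStarSubalgebra) ≠ 0
  center_trivial : ∀ z : M.toStarSubalgebra, (∀ x : M.toStarSubalgebra, z * x = x * z) →
    ∃ c : ℂ, z = c • (1 : M.toStarSubalgebra)
  finite : ∀ s : M.toStarSubalgebra, star s * s = 1 → s * star s = 1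
  no_minimal_projection : ∀ p : M.toStarSubalgebra, IsStarProjection p → p ≠ 0 →
    ∃ q : M.toStarSubalgebra, IsStarProjection q ∧ q ≠ 0 ∧ q ≠ p ∧ p * q = q

/-- A `*`-subalgebra `A` of `M` is a von Neumann subalgebra: as an algebra of operators on `H`
it is a von Neumann algebra. -/
def IsVonNeumannSubalgebra (M : VonNeumannAlgebra H) (A : StarSubalgebra ℂ M.toStarSubalgebra) :
    Prop :=
  ∃ N : VonNeumannAlgebra H, N.toStarSubalgebra = A.map M.toStarSubalgebra.subtype

end VonNeumann

end VNMasa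

namespace VNMasa

/-! ### The trace norm -/

section TraceNorm

variable {R : Type*} [CStarAlgebra R] {τ : R →ₗ[ℂ] ℂ}

/-! For fixed `x`, `y` the defect `T a = E(x a y) - E(x) E(y) a` is linear on `A`, and its adjoint
for `τ(a* b)` is the defect of `x*`, `y*` (`trace_star_mul_multDefect`). The hypothesis says that
`T` is Hilbert–Schmidt along `(v n)`. This property does not depend on the basis
(`summable_norm_sq_of_hilbertBasis`), so `T` is also square summable along the orthonormal powers
`u^k` of the unitary that `π` sends to `exp(2πit)`; hence `‖T(u^k)‖₂ → 0`. Density of the span of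
`Y` and bounds uniform in `k` give all `x`, `y`.

The three consequences follow from Pythagoras for `z_k = x u^k x*`: since `E(z_k)` is asymptotically
`E(x) E(x*) u^k`, the distance from `z_k` to `A` is controlled by `E(x)`
(`sq_sub_sq_le_of_tendsto`). A unitary `x` gives strong singularity, a nilpotent partial isometry
has `E(x) = 0` and gives `δ(A) = 1`, and for `x` commuting with `A` the defect is constant in norm,
which forces `x ∈ A`. -/

theorem IsNormalizedTrace.map_star (hτ : IsNormalizedTrace τ) (x : R) :
    τ (star x) = star (τ x) := by
  have him : ∀ y : R, (τ (star y * y)).im = 0 := fun y =>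
    (Complex.nonneg_iff.1 (hτ.nonneg y)).2.symm
  -- Reality of `τ(y* y)` at `1 + x` compares the imaginary parts of `τ(x)` and `τ(x*)`; at `1 + ix`
  -- it compares the real parts.
  have h0 := him x
  have h1 := him (1 + x)
  have h2 := him (1 + Complex.I • x)
  simp only [star_add, star_one, star_smul, add_mul, mul_add, one_mul, mul_one, map_add, hτ.map_one,
    smul_mul_assoc, mul_smul_comm, map_smul, smul_eq_mul, Complex.add_im, Complex.one_im,
    Complex.mul_im, Complex.I_re, Complex.I_im, Complex.star_def, Complex.conj_I, Complex.neg_re,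
    Complex.neg_im, Complex.mul_re] at h1 h2
  apply Complex.ext
  · simp; linarith
  · simp; linarith

/-- The algebra `R` as a vector space with the inner product `τ(x* y)`. -/
def TraceSpace (_ : IsNormalizedTrace τ) : Type _ := R

namespace TraceSpace

variable (hτ : IsNormalizedTrace τ)

noncomputable instance : AddCommGroup (TraceSpace hτ) := inferInstanceAs (AddCommGroup R)

noncomputable instance : Module ℂ (TraceSpace hτ) := inferInstanceAs (Module ℂ R)

/-- The identity map from `R` to `TraceSpace`. -/
noncomputable def of : R ≃ₗ[ℂ] TraceSpace hτ := LinearEquiv.refl ℂ R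

/-- `R` already carries its operator norm, so the trace inner product lives on a copy of it. -/
noncomputable instance core : InnerProductSpace.Core ℂ (TraceSpace hτ) where
  inner x y := τ (star ((of hτ).symm x) * (of hτ).symm y)
  conj_inner_symm x y := by
    rw [← Complex.star_def, ← hτ.map_star, star_mul, star_star]
  re_inner_nonneg x := (Complex.nonneg_iff.1 (hτ.nonneg _)).1
  add_left x y z := by simp [add_mul]
  smul_left x y r := by simp
  definite x h := (of hτ).symm.map_eq_zero_iff.1 (hτ.faithful _ h)

noncomputable instance : NormedAddCommGroup (TraceSpace hτ) :=
  InnerProductSpace.Core.toNormedAddCommGroup (cd := core hτ)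

noncomputable instance : InnerProductSpace ℂ (TraceSpace hτ) :=
  InnerProductSpace.ofCore (core hτ).toCore

theorem inner_of (x y : R) : inner ℂ (of hτ x) (of hτ y) = τ (star x * y) := rfl

theorem norm_of (x : R) : ‖of hτ x‖ = l2Norm τ x := rfl

end TraceSpace

open TraceSpace

theorem IsNormalizedTrace.l2Norm_sq (hτ : IsNormalizedTrace τ) (x : R) :
    l2Norm τ x ^ 2 = (τ (star x * x)).re :=
  Real.sq_sqrt (Complex.nonneg_iff.1 (hτ.nonneg _)).1

theorem IsNormalizedTrace.trace_star_mul_self (hτ : IsNormalizedTrace τ) (x : R) :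
    τ (star x * x) = ((l2Norm τ x ^ 2 : ℝ) : ℂ) := by
  rw [hτ.l2Norm_sq]
  exact Complex.ext rfl (by simpa using (Complex.nonneg_iff.1 (hτ.nonneg x)).2.symm)


theorem l2Norm_nonneg (x : R) : 0 ≤ l2Norm τ x := Real.sqrt_nonneg _

theorem l2Norm_unitary_mul {u : R} (hu : u ∈ unitary R) (x : R) :
    l2Norm τ (u * x) = l2Norm τ x := by
  rw [l2Norm, star_mul, mul_assoc, ← mul_assoc (star u), Unitary.star_mul_self_of_mem hu, one_mul,
    l2Norm]

namespace IsNormalizedTrace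

theorem l2Norm_zero (hτ : IsNormalizedTrace τ) : l2Norm τ 0 = 0 := by
  rw [← norm_of hτ, map_zero, norm_zero]

theorem l2Norm_add_le (hτ : IsNormalizedTrace τ) (x y : R) :
    l2Norm τ (x + y) ≤ l2Norm τ x + l2Norm τ y := by
  simpa only [← norm_of hτ, map_add] using norm_add_le (of hτ x) (of hτ y)

theorem l2Norm_sub_le (hτ : IsNormalizedTrace τ) (x y : R) :
    l2Norm τ (x - y) ≤ l2Norm τ x + l2Norm τ y := by
  simpa only [← norm_of hτ, map_sub] using norm_sub_le (of hτ x) (of hτ y)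

theorem l2Norm_smul (hτ : IsNormalizedTrace τ) (c : ℂ) (x : R) :
    l2Norm τ (c • x) = ‖c‖ * l2Norm τ x := by
  simpa only [← norm_of hτ, map_smul] using norm_smul c (of hτ x)

theorem l2Norm_eq_zero (hτ : IsNormalizedTrace τ) {x : R} : l2Norm τ x = 0 ↔ x = 0 := by
  rw [← norm_of hτ, norm_eq_zero, LinearEquiv.map_eq_zero_iff]

theorem norm_trace_le (hτ : IsNormalizedTrace τ) (x y : R) :
    ‖τ (star x * y)‖ ≤ l2Norm τ x * l2Norm τ y := by
  simpa only [← norm_of hτ, ← inner_of hτ] using norm_inner_le_norm (of hτ x) (of hτ y)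

theorem l2Norm_star (hτ : IsNormalizedTrace τ) (x : R) : l2Norm τ (star x) = l2Norm τ x := by
  rw [l2Norm, l2Norm, star_star, hτ.map_mul_comm]

/-- Left multiplication by `x` is bounded by the operator norm of `x` for the trace norm. -/
theorem l2Norm_mul_le (hτ : IsNormalizedTrace τ) (x y : R) :
    l2Norm τ (x * y) ≤ ‖x‖ * l2Norm τ y := by
  let _ : PartialOrder R := CStarAlgebra.spectralOrder R
  have : StarOrderedRing R := CStarAlgebra.spectralOrderedRing R
  -- Writing `‖x‖² - x* x = c* c` gives `‖x y‖₂² = ‖x‖² ‖y‖₂² - ‖c y‖₂²`.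
  obtain ⟨c, hc⟩ := CStarAlgebra.nonneg_iff_eq_star_mul_self.1
    (sub_nonneg.2 (CStarAlgebra.star_mul_le_algebraMap_norm_sq (a := x)))
  have h1 : star (x * y) * (x * y) = ((‖x‖ ^ 2 : ℝ) : ℂ) • (star y * y) - star (c * y) * (c * y) := by
    have h2 : star (x * y) * (x * y) = star y * (star x * x) * y := by simp [mul_assoc]
    have h3 : star (c * y) * (c * y) = star y * (star c * c) * y := by simp [mul_assoc]
    rw [h2, h3, ← hc, mul_sub (star y), sub_mul, Algebra.algebraMap_eq_smul_one]
    rw [Complex.coe_smul, mul_smul_comm, mul_one, smul_mul_assoc, sub_sub_cancel]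
  have h4 : l2Norm τ (x * y) ^ 2 ≤ (‖x‖ * l2Norm τ y) ^ 2 := by
    rw [mul_pow, hτ.l2Norm_sq, h1, map_sub, map_smul, Complex.sub_re, smul_eq_mul,
      Complex.re_ofReal_mul, ← hτ.l2Norm_sq, ← hτ.l2Norm_sq]
    linarith [sq_nonneg (l2Norm τ (c * y))]
  exact le_of_sq_le_sq h4 (mul_nonneg (norm_nonneg _) (l2Norm_nonneg _))

theorem l2Norm_mul_le' (hτ : IsNormalizedTrace τ) (x y : R) :
    l2Norm τ (x * y) ≤ l2Norm τ x * ‖y‖ := by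
  rw [← hτ.l2Norm_star, star_mul, mul_comm, ← hτ.l2Norm_star x, ← norm_star y]
  exact hτ.l2Norm_mul_le _ _

theorem l2Norm_one (hτ : IsNormalizedTrace τ) : l2Norm τ (1 : R) = 1 := by
  simp [l2Norm, hτ.map_one]

theorem l2Norm_le_norm (hτ : IsNormalizedTrace τ) (x : R) : l2Norm τ x ≤ ‖x‖ := by
  simpa [hτ.l2Norm_one] using hτ.l2Norm_mul_le x 1

theorem l2Norm_mul_unitary (hτ : IsNormalizedTrace τ) {u : R} (hu : u ∈ unitary R) (x : R) :
    l2Norm τ (x * u) = l2Norm τ x := by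
  rw [← hτ.l2Norm_star, star_mul, l2Norm_unitary_mul (Unitary.star_mem hu), hτ.l2Norm_star]

end IsNormalizedTrace

/-! ### Trace preserving conditional expectations -/

section CondExp

variable {A : StarSubalgebra ℂ R}

theorem eq_of_trace_mul_eq (hτ : IsNormalizedTrace τ) {y z : R} (hy : y ∈ A) (hz : z ∈ A)
    (h : ∀ a ∈ A, τ (y * a) = τ (z * a)) : y = z := by
  have hyz : y - z ∈ A := sub_mem hy hz
  have h1 := h _ (star_mem hyz)
  rw [← sub_eq_zero, ← map_sub, ← sub_mul, hτ.map_mul_comm] at h1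
  exact sub_eq_zero.1 (hτ.faithful _ h1)

theorem traceCondExp_eq (hτ : IsNormalizedTrace τ) {x y : R} (hy : y ∈ A)
    (h : ∀ a ∈ A, τ (y * a) = τ (x * a)) : traceCondExp τ A x = y := by
  have hex : ∃ y ∈ A, ∀ a ∈ A, τ (y * a) = τ (x * a) := ⟨y, hy, h⟩
  rw [traceCondExp, dif_pos hex]
  exact eq_of_trace_mul_eq hτ hex.choose_spec.1 hy
    fun a ha => (hex.choose_spec.2 a ha).trans (h a ha).symm

theorem traceCondExp_of_mem (hτ : IsNormalizedTrace τ) {x : R} (hx : x ∈ A) :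
    traceCondExp τ A x = x :=
  traceCondExp_eq hτ hx fun _ _ => rfl

/-- Cauchy–Schwarz applied to `‖E(x)‖₂² = τ(E(x)* x)`. The default value `0` makes the bound
unconditional, so it also applies to conjugates of `A` without an existence proof there. -/
theorem l2Norm_traceCondExp_le (hτ : IsNormalizedTrace τ) (A : StarSubalgebra ℂ R) (x : R) :
    l2Norm τ (traceCondExp τ A x) ≤ l2Norm τ x := by
  by_cases hex : ∃ y ∈ A, ∀ a ∈ A, τ (y * a) = τ (x * a)
  · obtain ⟨y, hy, h⟩ := hex
    rw [traceCondExp_eq hτ hy h]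
    have h1 := h _ (star_mem hy)
    rw [hτ.map_mul_comm, hτ.trace_star_mul_self, hτ.map_mul_comm] at h1
    have h2 := hτ.norm_trace_le y x
    rw [← h1, Complex.norm_real, Real.norm_of_nonneg (sq_nonneg _), sq] at h2
    rcases (l2Norm_nonneg (τ := τ) y).eq_or_lt with h3 | h3
    · rw [← h3]; exact l2Norm_nonneg _
    · exact le_of_mul_le_mul_left h2 h3
  · rw [traceCondExp, dif_neg hex, hτ.l2Norm_zero]; exact l2Norm_nonneg _

theorem l2Norm_sub_traceCondExp_le_of_norm_le_one (hτ : IsNormalizedTrace τ)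
    (A : StarSubalgebra ℂ R) {x : R} (hx : ‖x‖ ≤ 1) :
    l2Norm τ (x - traceCondExp τ A x) ≤ 2 := by
  linarith [hτ.l2Norm_sub_le x (traceCondExp τ A x), l2Norm_traceCondExp_le hτ A x,
    hτ.l2Norm_le_norm x]

/-- Every element of `R` has a trace preserving conditional expectation on `A`. -/
def HasTraceCondExp (τ : R →ₗ[ℂ] ℂ) (A : StarSubalgebra ℂ R) : Prop :=
  ∀ x, ∃ y ∈ A, ∀ a ∈ A, τ (y * a) = τ (x * a)

namespace HasTraceCondExp

theorem mem (hE : HasTraceCondExp τ A) (x : R) : traceCondExp τ A x ∈ A := by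
  rw [traceCondExp, dif_pos (hE x)]; exact (hE x).choose_spec.1

theorem trace_mul (hE : HasTraceCondExp τ A) (x : R) {a : R} (ha : a ∈ A) :
    τ (traceCondExp τ A x * a) = τ (x * a) := by
  rw [traceCondExp, dif_pos (hE x)]; exact (hE x).choose_spec.2 a ha

/-- The conditional expectation as a linear map. -/
noncomputable def condExp (hE : HasTraceCondExp τ A) (hτ : IsNormalizedTrace τ) : R →ₗ[ℂ] R where
  toFun := traceCondExp τ A
  map_add' x y := traceCondExp_eq hτ (add_mem (hE.mem x) (hE.mem y)) fun a ha => by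
    rw [add_mul, add_mul, map_add, map_add, hE.trace_mul x ha, hE.trace_mul y ha]
  map_smul' c x := traceCondExp_eq hτ (SMulMemClass.smul_mem c (hE.mem x)) fun a ha => by
    simp only [RingHom.id_apply, smul_mul_assoc, map_smul, hE.trace_mul x ha]

theorem map_mul_right (hE : HasTraceCondExp τ A) (hτ : IsNormalizedTrace τ) (x : R) {a : R}
    (ha : a ∈ A) : traceCondExp τ A (x * a) = traceCondExp τ A x * a :=
  traceCondExp_eq hτ (mul_mem (hE.mem x) ha) fun b hb => by
    rw [mul_assoc, mul_assoc, hE.trace_mul x (mul_mem ha hb)]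

theorem map_mul_left (hE : HasTraceCondExp τ A) (hτ : IsNormalizedTrace τ) (x : R) {a : R}
    (ha : a ∈ A) : traceCondExp τ A (a * x) = a * traceCondExp τ A x :=
  traceCondExp_eq hτ (mul_mem ha (hE.mem x)) fun b hb => by
    rw [mul_assoc, hτ.map_mul_comm, mul_assoc, hE.trace_mul x (mul_mem hb ha), mul_assoc,
      hτ.map_mul_comm a, mul_assoc]

theorem map_star (hE : HasTraceCondExp τ A) (hτ : IsNormalizedTrace τ) (x : R) :
    traceCondExp τ A (star x) = star (traceCondExp τ A x) :=
  traceCondExp_eq hτ (star_mem (hE.mem x)) fun a ha => by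
    have h := congrArg star (hE.trace_mul x (star_mem ha))
    rw [← hτ.map_star, ← hτ.map_star, star_mul, star_mul, star_star] at h
    rw [hτ.map_mul_comm, h, hτ.map_mul_comm]

theorem trace_star_mul (hE : HasTraceCondExp τ A) (hτ : IsNormalizedTrace τ) (x : R) {a : R}
    (ha : a ∈ A) : τ (star a * traceCondExp τ A x) = τ (star a * x) := by
  rw [hτ.map_mul_comm, hE.trace_mul x (star_mem ha), hτ.map_mul_comm]

/-- Multiplication by `E_A(x)` on `A` is bounded by `‖x‖` for the trace norm. -/
theorem l2Norm_mul_le (hE : HasTraceCondExp τ A) (hτ : IsNormalizedTrace τ) (x : R) {a : R}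
    (ha : a ∈ A) : l2Norm τ (traceCondExp τ A x * a) ≤ ‖x‖ * l2Norm τ a := by
  rw [← hE.map_mul_right hτ x ha]
  exact (l2Norm_traceCondExp_le hτ A _).trans (hτ.l2Norm_mul_le x a)

/-- Pythagoras for the orthogonal decomposition `x = E_A(x) + (x - E_A(x))`. -/
theorem l2Norm_sub_sq (hE : HasTraceCondExp τ A) (hτ : IsNormalizedTrace τ) (x : R) :
    l2Norm τ (x - traceCondExp τ A x) ^ 2 = l2Norm τ x ^ 2 - l2Norm τ (traceCondExp τ A x) ^ 2 := by
  have h1 := hE.trace_star_mul hτ x (hE.mem x)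
  have h2 := congrArg star h1
  rw [← hτ.map_star, ← hτ.map_star] at h2
  simp only [star_mul, star_star] at h2
  rw [hτ.l2Norm_sq, hτ.l2Norm_sq, hτ.l2Norm_sq, star_sub, sub_mul, mul_sub, mul_sub,
    map_sub, map_sub, map_sub, ← h1, ← h2]
  simp

end HasTraceCondExp

end CondExp

end TraceNorm

/-! ### Consequences of the asymptotic homomorphism property -/

section AsymptoticHomomorphism

variable {R : Type*} [CStarAlgebra R] {τ : R →ₗ[ℂ] ℂ} {A : StarSubalgebra ℂ R}

theorem coe_zpow_mem {u : unitary R} (hu : (u : R) ∈ A) (k : ℤ) :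
    ((u ^ k : unitary R) : R) ∈ A := by
  cases k with
  | ofNat n => simpa using pow_mem hu n
  | negSucc n =>
    rw [zpow_negSucc, ← Unitary.star_eq_inv, Unitary.coe_star]
    exact star_mem (by simpa using pow_mem hu (n + 1))

theorem norm_coe_unitary_le_one (u : unitary R) : ‖(u : R)‖ ≤ 1 := by
  nontriviality R
  exact (CStarRing.norm_coe_unitary u).le

/-- If `x*` commutes with every `u^k`, the defect of `x`, `x*` at `u^k` has norm independent of `k`,
so it vanishes and `E(x x*) = E(x) E(x)*`. Taking traces, `‖x‖₂ = ‖E(x)‖₂`, and Pythagoras gives `x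
= E(x)`. -/
theorem IsAsymptoticHomomorphism.isMasa (h : IsAsymptoticHomomorphism τ A)
    (hτ : IsNormalizedTrace τ) (hE : HasTraceCondExp τ A) (hA : IsAbelian A) : IsMasa A := by
  obtain ⟨u, hu, hlim⟩ := h
  refine ⟨hA, fun B hB hAB x hx => ?_⟩
  have hconst : ∀ k : ℤ, l2Norm τ (traceCondExp τ A (x * ((u ^ k : unitary R) : R) * star x)
      - traceCondExp τ A x * traceCondExp τ A (star x) * ((u ^ k : unitary R) : R)) =
      l2Norm τ (traceCondExp τ A (x * star x) - traceCondExp τ A x * traceCondExp τ A (star x)) := by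
    intro k
    have hk := coe_zpow_mem hu k
    rw [mul_assoc, hB _ (hAB hk) _ (star_mem hx), ← mul_assoc, hE.map_mul_right hτ _ hk, ← sub_mul,
      hτ.l2Norm_mul_unitary (u ^ k).2]
  have h0 := tendsto_nhds_unique (tendsto_const_nhds.congr fun k => (hconst k).symm)
    (hlim x (star x))
  rw [hτ.l2Norm_eq_zero, sub_eq_zero, hE.map_star hτ] at h0
  have h1 := congrArg τ h0
  rw [← mul_one (traceCondExp τ A (x * star x)), hE.trace_mul _ (one_mem A), mul_one,
    hτ.map_mul_comm, hτ.map_mul_comm (traceCondExp τ A x), hτ.trace_star_mul_self,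
    hτ.trace_star_mul_self, Complex.ofReal_inj] at h1
  have h2 := hE.l2Norm_sub_sq hτ x
  rw [h1, sub_self, sq_eq_zero_iff, hτ.l2Norm_eq_zero, sub_eq_zero] at h2
  rw [h2]
  exact hE.mem x

/-- If `‖E_A(z_k) - E_A(x) E_A(y) u^k‖₂ → 0` with `‖z_k‖₂ = c` and `‖E_A(x) E_A(y) u^k‖₂ ≤ d`, then
any upper bound of all `‖z_k - E_A(z_k)‖₂` is at least `(c² - d²)^{1/2}`. -/
theorem sq_sub_sq_le_of_tendsto (hτ : IsNormalizedTrace τ) (hE : HasTraceCondExp τ A)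
    {z w : ℤ → R} {c d s : ℝ}
    (hlim : Tendsto (fun k => l2Norm τ (traceCondExp τ A (z k) - w k)) cofinite (𝓝 0))
    (hz : ∀ k, l2Norm τ (z k) = c) (hw : ∀ k, l2Norm τ (w k) ≤ d)
    (hs : ∀ k, l2Norm τ (z k - traceCondExp τ A (z k)) ≤ s) :
    c ^ 2 - d ^ 2 ≤ s ^ 2 := by
  have h1 : ∀ k, c ^ 2 - (l2Norm τ (traceCondExp τ A (z k) - w k) + d) ^ 2 ≤ s ^ 2 := by
    intro k
    have h2 := hE.l2Norm_sub_sq hτ (z k)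
    have h3 : l2Norm τ (traceCondExp τ A (z k)) ≤
        l2Norm τ (traceCondExp τ A (z k) - w k) + d := by
      have := hτ.l2Norm_add_le (traceCondExp τ A (z k) - w k) (w k)
      rw [sub_add_cancel] at this
      linarith [hw k]
    have h4 := pow_le_pow_left₀ (l2Norm_nonneg _) h3 2
    have h5 := pow_le_pow_left₀ (l2Norm_nonneg _) (hs k) 2
    rw [hz k] at h2
    linarith
  have h6 : Tendsto (fun k => c ^ 2 - (l2Norm τ (traceCondExp τ A (z k) - w k) + d) ^ 2) cofinite
      (𝓝 (c ^ 2 - (0 + d) ^ 2)) := tendsto_const_nhds.sub ((hlim.add_const d).pow 2)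
  rw [zero_add] at h6
  exact le_of_tendsto h6 (Eventually.of_forall h1)

/-- The unitaries `w u^k w*` are fixed by the expectation onto `w A w*`, so their distances to `A`
are at most `‖E_{wAw*} - E_A‖_{∞,2}`. In the limit this dominates `(1 - ‖E(w)‖₂²)^{1/2} = ‖w -
E(w)‖₂`. -/
theorem IsAsymptoticHomomorphism.isStronglySingularMasa (h : IsAsymptoticHomomorphism τ A)
    (hτ : IsNormalizedTrace τ) (hE : HasTraceCondExp τ A) (hA : IsAbelian A) :
    IsStronglySingularMasa τ A := by
  refine ⟨h.isMasa hτ hE hA, fun w => ?_⟩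
  obtain ⟨u, hu, hlim⟩ := h
  -- The real `sSup` of an unbounded set is `0`, so boundedness must be known before `le_csSup`
  -- applies.
  have hbdd : BddAbove {r : ℝ | ∃ x : R, ‖x‖ ≤ 1 ∧
      r = l2Norm τ (traceCondExp τ (conj w A) x - traceCondExp τ A x)} := by
    refine ⟨2, ?_⟩
    rintro r ⟨x, hx, rfl⟩
    linarith [hτ.l2Norm_sub_le (traceCondExp τ (conj w A) x) (traceCondExp τ A x),
      l2Norm_traceCondExp_le hτ A x, l2Norm_traceCondExp_le hτ (conj w A) x, hτ.l2Norm_le_norm x]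
  have hone : ∀ v : unitary R, l2Norm τ (v : R) = 1 := fun v => by
    rw [← mul_one (v : R), l2Norm_unitary_mul v.2, hτ.l2Norm_one]
  have key := sq_sub_sq_le_of_tendsto hτ hE (c := 1) (d := l2Norm τ (traceCondExp τ A (w : R)))
    (s := normInftyTwo τ (fun x => traceCondExp τ (conj w A) x - traceCondExp τ A x))
    (hlim w (star w)) (fun k => ?_) (fun k => ?_) (fun k => ?_)
  · rw [← hone w, ← hE.l2Norm_sub_sq hτ] at key
    refine le_of_sq_le_sq key (Real.sSup_nonneg ?_)
    rintro r ⟨x, -, rfl⟩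
    exact l2Norm_nonneg _
  · exact hone (w * u ^ k * star w)
  · rw [hτ.l2Norm_mul_unitary (u ^ k).2, hA _ (hE.mem _) _ (hE.mem _)]
    refine (hE.l2Norm_mul_le hτ _ (hE.mem _)).trans ?_
    rw [norm_star]
    exact mul_le_of_le_one_left (l2Norm_nonneg _) (norm_coe_unitary_le_one w)
  · have hmem : (w : R) * ((u ^ k : unitary R) : R) * star (w : R) ∈ conj w A :=
      ⟨_, coe_zpow_mem hu k, by simp [Unitary.conjStarAlgAut_apply]⟩
    refine le_csSup hbdd ⟨(w : R) * ((u ^ k : unitary R) : R) * star (w : R), ?_, by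
      simp only [traceCondExp_of_mem hτ hmem]⟩
    exact norm_coe_unitary_le_one (w * u ^ k * star w)

/-- With `p = v* v` and `q = v v*` in `A`, `E(v) = q E(v) p = E(v) p q`, and `p q = v* v v v* = 0`.
Thus `E(v) = 0`, and `v u^k v*` becomes asymptotically orthogonal to `A`. -/
theorem IsAsymptoticHomomorphism.l2Norm_le_conjDeviation (h : IsAsymptoticHomomorphism τ A)
    (hτ : IsNormalizedTrace τ) (hE : HasTraceCondExp τ A) {v : R}
    (hv : v * star v * v = v) (hv2 : v * v = 0) (hp : star v * v ∈ A) (hq : v * star v ∈ A)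
    (hA : IsAbelian A) : l2Norm τ (v * star v) ≤ conjDeviation τ A v := by
  obtain ⟨u, hu, hlim⟩ := h
  have hE0 : traceCondExp τ A v = 0 := by
    have h1 : traceCondExp τ A v = v * star v * traceCondExp τ A v * (star v * v) := by
      rw [← hE.map_mul_left hτ _ hq, ← hE.map_mul_right hτ _ hp, hv, ← mul_assoc, hv]
    rw [h1, hA _ hq _ (hE.mem v), mul_assoc, hA _ hq _ hp, mul_assoc (star v), ← mul_assoc v v, hv2,
      zero_mul, mul_zero, mul_zero]
  have hnv : ‖v‖ ≤ 1 := by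
    have hproj : IsStarProjection (star v * v) :=
      ⟨by rw [IsIdempotentElem, mul_assoc, ← mul_assoc v, hv], IsSelfAdjoint.star_mul_self v⟩
    have h2 := hproj.norm_le
    rw [CStarRing.norm_star_mul_self] at h2
    nlinarith [norm_nonneg v]
  have hbdd : BddAbove {r : ℝ | ∃ a ∈ A, ‖v * a * star v‖ ≤ 1 ∧
      r = l2Norm τ (v * a * star v - traceCondExp τ A (v * a * star v))} := by
    refine ⟨2, ?_⟩
    rintro r ⟨a, -, ha, rfl⟩
    exact l2Norm_sub_traceCondExp_le_of_norm_le_one hτ A ha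
  have key := sq_sub_sq_le_of_tendsto hτ hE (c := l2Norm τ (v * star v)) (d := 0)
    (s := conjDeviation τ A v) (hlim v (star v)) (fun k => ?_) (fun k => ?_) (fun k => ?_)
  · rw [zero_pow two_ne_zero, sub_zero] at key
    refine le_of_sq_le_sq key (Real.sSup_nonneg ?_)
    rintro r ⟨a, -, -, rfl⟩
    exact l2Norm_nonneg _
  · have hk := coe_zpow_mem hu k
    have hu1 := Unitary.star_mul_self_of_mem (u ^ k).2
    have hvs : star v * v * star v = star v := by simpa [mul_assoc] using congrArg star hv
    set a := ((u ^ k : unitary R) : R)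
    -- Since `u^k` commutes with `v* v`, the element `v u^k v*` has the same trace norm as `v v*`.
    have h3 : star (v * a * star v) * (v * a * star v) = v * star v := by
      calc star (v * a * star v) * (v * a * star v)
          = v * (star a * (star v * v * a)) * star v := by simp [mul_assoc]
        _ = v * (star a * a * (star v * v)) * star v := by rw [hA _ hp _ hk, mul_assoc (star a)]
        _ = v * star v := by rw [hu1, one_mul, mul_assoc v, hvs]
    have h4 : star (v * star v) * (v * star v) = v * star v := by
      rw [star_mul, star_star, ← mul_assoc, hv]
    rw [l2Norm, l2Norm, h3, h4]
  · rw [hE0, zero_mul, zero_mul, hτ.l2Norm_zero]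
  · refine le_csSup hbdd ⟨_, coe_zpow_mem hu k, ?_, rfl⟩
    have h5 := norm_mul₃_le (a := v) (b := ((u ^ k : unitary R) : R)) (c := star v)
    rw [norm_star] at h5
    refine h5.trans (mul_le_one₀ (mul_le_one₀ hnv (norm_nonneg _) ?_) (norm_nonneg _) hnv)
    exact norm_coe_unitary_le_one _

theorem IsAsymptoticHomomorphism.popaDelta_eq_one (h : IsAsymptoticHomomorphism τ A)
    (hτ : IsNormalizedTrace τ) (hE : HasTraceCondExp τ A) (hA : IsAbelian A) :
    popaDelta τ A = 1 := by
  refine IsGreatest.csSup_eq ⟨⟨zero_le_one, le_rfl, fun v hv hv2 hp hq => ?_⟩, fun c hc => hc.2.1⟩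
  rw [one_mul]
  exact h.l2Norm_le_conjDeviation hτ hE hv hv2 hp hq hA

end AsymptoticHomomorphism

/-! ### Basis independence of the Hilbert–Schmidt property -/

section HilbertSchmidt

/-- Tonelli for a nonnegative double series: summable row sums force summable column sums. -/
theorem summable_of_hasSum_comm {α β : Type*} {F : α → β → ℝ} (hF : ∀ a b, 0 ≤ F a b) {r : α → ℝ}
    (hr : ∀ a, HasSum (F a) (r a)) (hrs : Summable r) {c : β → ℝ}
    (hc : ∀ b, HasSum (fun a => F a b) (c b)) : Summable c := by
  have h1 : Summable fun p : α × β => F p.1 p.2 :=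
    (summable_prod_of_nonneg fun p => hF p.1 p.2).2
      ⟨fun a => (hr a).summable, hrs.congr fun a => (hr a).tsum_eq.symm⟩
  have h2 := h1.prod_symm.prod
  exact h2.congr fun b => (hc b).tsum_eq

theorem hasSum_norm_inner_sq {ι E : Type*} [NormedAddCommGroup E] [InnerProductSpace ℂ E]
    (b : HilbertBasis ι ℂ E) (x : E) :
    HasSum (fun i => ‖inner ℂ (b i) x‖ ^ 2) (‖x‖ ^ 2) := by
  have h := Complex.reCLM.hasSum (b.hasSum_inner_mul_inner x x)
  convert h using 1
  · ext i
    rw [← inner_conj_symm x (b i), mul_comm, RCLike.mul_conj]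
    norm_cast
  · exact (inner_self_eq_norm_sq (𝕜 := ℂ) x).symm

/-- If an operator with a formal adjoint, defined on vectors `J a`, is square summable along a
Hilbert basis, then it is square summable along every orthonormal family. -/
theorem summable_norm_sq_of_hilbertBasis {V E ι κ : Type*} [NormedAddCommGroup E]
    [InnerProductSpace ℂ E] {J : V → E} {T T' : V → V}
    (hadj : ∀ a b, inner ℂ (J a) (J (T b)) = inner ℂ (J (T' a)) (J b))
    (b : HilbertBasis ι ℂ E) {v : ι → V} (hb : ∀ i, b i = J (v i))
    {c : κ → V} (hc : Orthonormal ℂ (fun k => J (c k)))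
    (hsum : Summable fun i => ‖J (T (v i))‖ ^ 2) :
    Summable fun k => ‖J (T (c k))‖ ^ 2 := by
  -- Parseval on both sides: `T` and `T'` have transposed matrices in the basis `b`.
  have h1 : Summable fun i => ‖J (T' (v i))‖ ^ 2 := by
    refine summable_of_hasSum_comm (F := fun m n => ‖inner ℂ (J (v n)) (J (T (v m)))‖ ^ 2)
      (fun _ _ => sq_nonneg _) (fun m => ?_) hsum (fun n => ?_)
    · simpa only [hb] using hasSum_norm_inner_sq b (J (T (v m)))
    · simp only [hadj, norm_inner_symm (J (T' (v n)))]
      simpa only [hb] using hasSum_norm_inner_sq b (J (T' (v n)))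
  -- For `c` Bessel's inequality suffices, so completeness of the exponentials is never needed.
  refine summable_of_hasSum_comm (F := fun n k => ‖inner ℂ (J (T' (v n))) (J (c k))‖ ^ 2)
    (fun _ _ => sq_nonneg _) (r := fun n => ∑' k, ‖inner ℂ (J (T' (v n))) (J (c k))‖ ^ 2)
    (fun n => ?_) ?_ (fun k => ?_)
  · simp only [norm_inner_symm (J (T' (v n)))]
    exact (hc.inner_products_summable (J (T' (v n)))).hasSum
  · refine h1.of_nonneg_of_le (fun n => tsum_nonneg fun _ => sq_nonneg _) (fun n => ?_)
    simp only [norm_inner_symm (J (T' (v n)))]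
    exact hc.tsum_inner_products_le _
  · simp only [← hadj]
    simpa only [hb] using hasSum_norm_inner_sq b (J (T (c k)))

end HilbertSchmidt

/-! ### The multiplicativity defect and extension by density -/

section Extension

variable {R : Type*} [CStarAlgebra R] {τ : R →ₗ[ℂ] ℂ} {A : StarSubalgebra ℂ R}

/-- Convergence to zero in trace norm of a uniformly bounded family of linear maps extends from a
set with dense span. -/
theorem tendsto_l2Norm_of_hasL2DenseSpan (hτ : IsNormalizedTrace τ) {Y : Set R}
    (hY : HasL2DenseSpan τ ⊤ Y) {α : Type*} {l : Filter α} (f : α → R →ₗ[ℂ] R) {C : ℝ}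
    (hC : ∀ k x, l2Norm τ (f k x) ≤ C * l2Norm τ x)
    (h : ∀ y ∈ Y, Tendsto (fun k => l2Norm τ (f k y)) l (𝓝 0)) (x : R) :
    Tendsto (fun k => l2Norm τ (f k x)) l (𝓝 0) := by
  have hspan : ∀ z ∈ Submodule.span ℂ Y, Tendsto (fun k => l2Norm τ (f k z)) l (𝓝 0) := by
    intro z hz
    induction hz using Submodule.span_induction with
    | mem y hy => exact h y hy
    | zero => simpa only [map_zero, hτ.l2Norm_zero] using tendsto_const_nhds
    | add y z _ _ hy hz =>
      refine squeeze_zero (fun _ => l2Norm_nonneg _) (fun k => ?_) (by simpa using hy.add hz)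
      rw [map_add]
      exact hτ.l2Norm_add_le _ _
    | smul c y _ hy => simpa only [map_smul, hτ.l2Norm_smul, mul_zero] using hy.const_mul ‖c‖
  rw [Metric.tendsto_nhds]
  intro ε hε
  -- Dividing by `|C| + 1` covers `C` zero or negative.
  have hC1 : 0 < |C| + 1 := by positivity
  obtain ⟨z, hz, hxz⟩ := hY x trivial (ε / 2 / (|C| + 1)) (by positivity)
  filter_upwards [Metric.tendsto_nhds.1 (hspan z hz) (ε / 2) (half_pos hε)] with k hk
  rw [Real.dist_0_eq_abs, abs_of_nonneg (l2Norm_nonneg _)] at hk ⊢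
  have h1 := hτ.l2Norm_add_le (f k (x - z)) (f k z)
  rw [← map_add, sub_add_cancel] at h1
  have h2 : C * l2Norm τ (x - z) ≤ (|C| + 1) * l2Norm τ (x - z) :=
    mul_le_mul_of_nonneg_right (by linarith [le_abs_self C]) (l2Norm_nonneg _)
  rw [lt_div_iff₀ hC1, mul_comm] at hxz
  linarith [hC k (x - z)]

/-- The defect of multiplicativity `E_A(x u y) - E_A(x) E_A(y) u` of the conditional expectation. -/
noncomputable def multDefect (τ : R →ₗ[ℂ] ℂ) (A : StarSubalgebra ℂ R) (x y u : R) : R :=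
  traceCondExp τ A (x * u * y) - traceCondExp τ A x * traceCondExp τ A y * u

theorem multDefect_mem (hE : HasTraceCondExp τ A) (x y : R) {a : R} (ha : a ∈ A) :
    multDefect τ A x y a ∈ A :=
  sub_mem (hE.mem _) (mul_mem (mul_mem (hE.mem _) (hE.mem _)) ha)

/-- The formal adjoint of the multiplicativity defect. -/
theorem trace_star_mul_multDefect (hτ : IsNormalizedTrace τ) (hE : HasTraceCondExp τ A)
    (hA : IsAbelian A) (x y : R) {a b : R} (ha : a ∈ A) (hb : b ∈ A) :
    τ (star a * multDefect τ A x y b) = τ (star (multDefect τ A (star x) (star y) a) * b) := by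
  have h1 : τ (star a * traceCondExp τ A (x * b * y)) =
      τ (star (traceCondExp τ A (star x * a * star y)) * b) := by
    rw [hE.trace_star_mul hτ _ ha, ← hE.map_star hτ, hE.trace_mul _ hb]
    simp only [star_mul, star_star]
    rw [← mul_assoc, hτ.map_mul_comm]
    simp only [mul_assoc]
  have h2 : star a * (traceCondExp τ A x * traceCondExp τ A y * b) =
      star (traceCondExp τ A (star x) * traceCondExp τ A (star y) * a) * b := by
    rw [← star_star a, hE.map_star hτ, hE.map_star hτ]
    simp only [star_mul, star_star]
    rw [hA _ (hE.mem y) _ (hE.mem x)]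
    simp only [mul_assoc]
  rw [multDefect, multDefect, mul_sub, map_sub, h1, h2, star_sub, sub_mul, map_sub]

/-- One variable is extended at a time: first `y` with `x ∈ Y` fixed, then `x` with `y` arbitrary.
The fixed variable enters through operator norms, which gives a trace norm bound uniform in `k`
because the `u^k` are unitary. -/
theorem isAsymptoticHomomorphism_of_hasL2DenseSpan (hτ : IsNormalizedTrace τ)
    (hE : HasTraceCondExp τ A) {Y : Set R} (hY : HasL2DenseSpan τ ⊤ Y)
    {u : unitary R} (hu : (u : R) ∈ A)
    (h : ∀ x ∈ Y, ∀ y ∈ Y, Tendsto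
      (fun k : ℤ => l2Norm τ (multDefect τ A x y ((u ^ k : unitary R) : R))) cofinite (𝓝 0)) :
    IsAsymptoticHomomorphism τ A := by
  refine ⟨u, hu, ?_⟩
  have h1 : ∀ x ∈ Y, ∀ y, Tendsto
      (fun k : ℤ => l2Norm τ (multDefect τ A x y ((u ^ k : unitary R) : R))) cofinite (𝓝 0) := by
    intro x hx
    refine tendsto_l2Norm_of_hasL2DenseSpan hτ hY (fun k : ℤ =>
      hE.condExp hτ ∘ₗ LinearMap.mulLeft ℂ (x * ((u ^ k : unitary R) : R)) -
        LinearMap.mulRight ℂ ((u ^ k : unitary R) : R) ∘ₗ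
          LinearMap.mulLeft ℂ (traceCondExp τ A x) ∘ₗ hE.condExp hτ)
      (C := ‖x‖ + ‖traceCondExp τ A x‖) (fun k y => ?_) (h x hx)
    change l2Norm τ (traceCondExp τ A (x * ((u ^ k : unitary R) : R) * y) -
      traceCondExp τ A x * traceCondExp τ A y * ((u ^ k : unitary R) : R)) ≤ _
    refine (hτ.l2Norm_sub_le _ _).trans ?_
    rw [hτ.l2Norm_mul_unitary (u ^ k).2, add_mul]
    refine add_le_add ((l2Norm_traceCondExp_le hτ A _).trans ?_)
      ((hτ.l2Norm_mul_le _ _).trans ?_)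
    · rw [mul_assoc]
      refine (hτ.l2Norm_mul_le _ _).trans_eq ?_
      rw [l2Norm_unitary_mul (u ^ k).2]
    · exact mul_le_mul_of_nonneg_left (l2Norm_traceCondExp_le hτ A _) (norm_nonneg _)
  intro x y
  refine tendsto_l2Norm_of_hasL2DenseSpan hτ hY (fun k : ℤ =>
    hE.condExp hτ ∘ₗ LinearMap.mulRight ℂ y ∘ₗ LinearMap.mulRight ℂ ((u ^ k : unitary R) : R) -
      LinearMap.mulRight ℂ ((u ^ k : unitary R) : R) ∘ₗ
        LinearMap.mulRight ℂ (traceCondExp τ A y) ∘ₗ hE.condExp hτ)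
    (C := ‖y‖ + ‖traceCondExp τ A y‖) (fun k x => ?_) (fun x hx => h1 x hx y) x
  change l2Norm τ (traceCondExp τ A (x * ((u ^ k : unitary R) : R) * y) -
    traceCondExp τ A x * traceCondExp τ A y * ((u ^ k : unitary R) : R)) ≤ _
  refine (hτ.l2Norm_sub_le _ _).trans ?_
  rw [hτ.l2Norm_mul_unitary (u ^ k).2, add_mul, mul_comm ‖y‖, mul_comm ‖_‖]
  refine add_le_add ((l2Norm_traceCondExp_le hτ A _).trans ?_)
    ((hτ.l2Norm_mul_le' _ _).trans ?_)
  · refine (hτ.l2Norm_mul_le' _ _).trans_eq ?_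
    rw [hτ.l2Norm_mul_unitary (u ^ k).2]
  · exact mul_le_mul_of_nonneg_right (l2Norm_traceCondExp_le hτ A _) (norm_nonneg _)

end Extension

/-- Averaging gives `re (c f) ≤ ‖c‖ C` almost everywhere for each `c`. A countable dense set of `c`
shares one null set, continuity reaches every `c`, and `c = conj (f t)` yields the bound. -/
theorem ae_norm_le_of_forall_norm_setIntegral_le {α : Type*} {mα : MeasurableSpace α}
    {μ : Measure α} [IsFiniteMeasure μ] {f : α → ℂ} (hf : Integrable f μ) {C : ℝ} (hC : 0 ≤ C)
    (h : ∀ s, MeasurableSet s → ‖∫ t in s, f t ∂μ‖ ≤ C * μ.real s) : ∀ᵐ t ∂μ, ‖f t‖ ≤ C := by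
  have h1 : ∀ n, ∀ᵐ t ∂μ, (TopologicalSpace.denseSeq ℂ n * f t).re ≤
      ‖TopologicalSpace.denseSeq ℂ n‖ * C := by
    intro n
    set c := TopologicalSpace.denseSeq ℂ n
    refine ae_le_of_forall_setIntegral_le (f := fun t => (c * f t).re) (g := fun _ => ‖c‖ * C)
      (hf.const_mul c).re (integrable_const _) fun s hs _ => ?_
    have h2 : ∫ t in s, (c * f t).re ∂μ = (c * ∫ t in s, f t ∂μ).re := by
      rw [← integral_const_mul]
      exact integral_re ((hf.const_mul c).integrableOn (s := s))
    rw [h2, setIntegral_const, smul_eq_mul]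
    calc (c * ∫ t in s, f t ∂μ).re ≤ ‖c * ∫ t in s, f t ∂μ‖ := Complex.re_le_norm _
      _ ≤ ‖c‖ * (C * μ.real s) := by
        rw [norm_mul]; exact mul_le_mul_of_nonneg_left (h s hs) (norm_nonneg _)
      _ = μ.real s * (‖c‖ * C) := by ring
  filter_upwards [ae_all_iff.2 h1] with t ht
  have h3 : ∀ c : ℂ, (c * f t).re ≤ ‖c‖ * C := fun c =>
    (TopologicalSpace.denseRange_denseSeq ℂ).induction_on c
      (isClosed_le (by fun_prop) (by fun_prop)) ht
  have h4 := h3 (star (f t))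
  rw [Complex.star_def, Complex.conj_mul', RCLike.norm_conj] at h4
  norm_cast at h4
  rcases (norm_nonneg (f t)).eq_or_lt with h5 | h5
  · rwa [← h5]
  · exact le_of_mul_le_mul_left (by rwa [← sq]) h5

/-- Lebesgue measure on the unit interval. -/
noncomputable abbrev unitMeasure : Measure ℝ := volume.restrict (Set.Icc (0 : ℝ) 1)

/-! ### Transfer to `L^∞[0,1]` and the Fourier unitaries -/

section Isomorphism

variable {R : Type*} [CStarAlgebra R] {τ : R →ₗ[ℂ] ℂ} {A : StarSubalgebra ℂ R}
  {π : A ≃ₗ[ℂ] Lp ℂ ∞ unitMeasure}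

theorem memLp_two (f : Lp ℂ ∞ unitMeasure) : MemLp f 2 unitMeasure :=
  (Lp.memLp f).mono_exponent le_top

/-- The map from `A` to `L²[0,1]` induced by `π : A → L^∞[0,1]`. -/
noncomputable def toL2 (π : A ≃ₗ[ℂ] Lp ℂ ∞ unitMeasure) : A →ₗ[ℂ] Lp ℂ 2 unitMeasure where
  toFun a := (memLp_two (π a)).toLp
  map_add' a b := by
    rw [← MemLp.toLp_add]
    refine MemLp.toLp_congr _ _ ?_
    rw [map_add]
    exact Lp.coeFn_add _ _
  map_smul' c a := by
    rw [RingHom.id_apply, ← MemLp.toLp_const_smul]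
    refine MemLp.toLp_congr _ _ ?_
    rw [map_smul]
    exact Lp.coeFn_smul _ _

theorem coeFn_toL2 (a : A) : toL2 π a =ᵐ[unitMeasure] π a :=
  (memLp_two (π a)).coeFn_toLp

/-- Simple functions are bounded, hence in the image of `π`, and are dense in `L²`. -/
theorem denseRange_toL2 : DenseRange (toL2 π) := by
  refine (Lp.simpleFunc.denseRange (E := ℂ) (μ := unitMeasure) (p := 2)
    (by norm_num)).mono ?_
  rintro _ ⟨f, rfl⟩
  have hs : MemLp (Lp.simpleFunc.toSimpleFunc f) ∞ unitMeasure := SimpleFunc.memLp_top _ _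
  refine ⟨π.symm hs.toLp, Lp.ext ?_⟩
  refine (coeFn_toL2 _).trans ?_
  rw [LinearEquiv.apply_symm_apply]
  exact hs.coeFn_toLp.trans (Lp.simpleFunc.toSimpleFunc_eq_toFun f)

namespace IsL2IsometricStarIso

theorem norm_toL2 (hπ : IsL2IsometricStarIso τ A π) (a : A) : ‖toL2 π a‖ = l2Norm τ (a : R) := by
  change ‖(memLp_two (π a)).toLp‖ = _
  rw [Lp.norm_toLp, hπ.isometry, ENNReal.toReal_ofReal (l2Norm_nonneg _)]

theorem inner_toL2 (hπ : IsL2IsometricStarIso τ A π) (hτ : IsNormalizedTrace τ) (a b : A) :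
    inner ℂ (toL2 π a) (toL2 π b) = τ (star (a : R) * b) := by
  rw [← TraceSpace.inner_of hτ, inner_eq_sum_norm_sq_div_four,
    inner_eq_sum_norm_sq_div_four (TraceSpace.of hτ (a : R))]
  simp only [← map_add, ← map_sub, ← map_smul, TraceSpace.norm_of, hπ.norm_toL2]
  rfl

theorem trace_mul (hπ : IsL2IsometricStarIso τ A π) (hτ : IsNormalizedTrace τ) (a b : A) :
    τ ((a : R) * b) = ∫ t, π a t * π b t ∂unitMeasure := by
  have h := hπ.inner_toL2 hτ (star a) b
  rw [StarMemClass.coe_star, star_star, L2.inner_def] at h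
  rw [← h]
  refine integral_congr_ae ?_
  filter_upwards [coeFn_toL2 (π := π) (star a), coeFn_toL2 (π := π) b, hπ.map_star a]
    with t h1 h2 h3
  rw [h1, h2, h3, RCLike.inner_apply, Complex.star_def, Complex.conj_conj, mul_comm]

theorem eq_of_ae_eq {a b : A} (h : π a =ᵐ[unitMeasure] π b) : a = b :=
  π.injective (Lp.ext h)

theorem map_one (hπ : IsL2IsometricStarIso τ A π) : ∀ᵐ t ∂unitMeasure, π 1 t = 1 := by
  have hone : MemLp (fun _ : ℝ => (1 : ℂ)) ∞ unitMeasure := memLp_const 1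
  -- Surjectivity of `π` provides a preimage of the constant `1`, on which `π 1` acts as the
  -- identity.
  have h := hπ.map_mul 1 (π.symm hone.toLp)
  rw [one_mul, LinearEquiv.apply_symm_apply] at h
  filter_upwards [h, hone.coeFn_toLp] with t h1 h2
  rwa [h2, mul_one, eq_comm] at h1

/-- By Riesz, `τ(x a) = ∫ conj(g) π(a)` for some `g ∈ L²`. Testing on the projections `p` of `A`
given by indicators of sets `s` yields `|∫_s conj(g)| ≤ ‖x‖ |s|`, so `conj(g)` is bounded and its
preimage under `π` is `E(x)`. -/
theorem hasTraceCondExp (hπ : IsL2IsometricStarIso τ A π) (hτ : IsNormalizedTrace τ) :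
    HasTraceCondExp τ A := by
  intro x
  let f : A →ₗ[ℂ] ℂ := τ ∘ₗ LinearMap.mulLeft ℂ x ∘ₗ A.toSubmodule.subtype
  have hf : ∀ a : A, f a = τ (x * a) := fun _ => rfl
  have hbd : ∀ a : A, ‖f a‖ ≤ l2Norm τ (star x) * ‖toL2 π a‖ := fun a => by
    rw [hf, hπ.norm_toL2]
    simpa using hτ.norm_trace_le (star x) (a : R)
  let g : Lp ℂ 2 unitMeasure := (InnerProductSpace.toDual ℂ _).symm (f.extendOfNorm (toL2 π))
  have hg : ∀ a : A, τ (x * a) = ∫ t, star (g t) * π a t ∂unitMeasure := fun a => by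
    have h1 : inner ℂ g (toL2 π a) = f.extendOfNorm (toL2 π) (toL2 π a) :=
      InnerProductSpace.toDual_symm_apply
    rw [LinearMap.extendOfNorm_eq denseRange_toL2 ⟨_, hbd⟩, L2.inner_def, hf] at h1
    rw [← h1]
    refine integral_congr_ae ?_
    filter_upwards [coeFn_toL2 (π := π) a] with t h2
    rw [h2, RCLike.inner_apply, Complex.star_def, mul_comm]
  have hgL2 : MemLp (fun t => star (g t)) 2 unitMeasure := (Lp.memLp g).star
  have hbound : ∀ᵐ t ∂unitMeasure, ‖star (g t)‖ ≤ ‖x‖ := by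
    refine ae_norm_le_of_forall_norm_setIntegral_le (hgL2.integrable (by norm_num))
      (norm_nonneg x) fun s hs => ?_
    have hind : MemLp (s.indicator fun _ => (1 : ℂ)) ∞ unitMeasure :=
      memLp_indicator_const ∞ hs 1 (Or.inr (measure_ne_top _ _))
    let p : A := π.symm hind.toLp
    have hp : π p =ᵐ[unitMeasure] s.indicator fun _ => (1 : ℂ) := by
      rw [LinearEquiv.apply_symm_apply]; exact hind.coeFn_toLp
    have hpmul : p * p = p := eq_of_ae_eq (π := π) <| by
      filter_upwards [hπ.map_mul p p, hp] with t h1 h2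
      rw [h1, h2]
      by_cases ht : t ∈ s <;> simp [ht]
    have hpstar : star p = p := eq_of_ae_eq (π := π) <| by
      filter_upwards [hπ.map_star p, hp] with t h1 h2
      rw [h1, h2]
      by_cases ht : t ∈ s <;> simp [ht]
    have hpmul' : (p : R) * p = p := congrArg Subtype.val hpmul
    have hpstar' : star (p : R) = p := congrArg Subtype.val hpstar
    have h4 : τ (x * p) = ∫ t in s, star (g t) ∂unitMeasure := by
      rw [hg, ← integral_indicator hs]
      refine integral_congr_ae ?_
      filter_upwards [hp] with t h1
      rw [h1]
      by_cases ht : t ∈ s <;> simp [ht]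
    -- Using `p` twice makes Cauchy–Schwarz produce `‖p‖₂² = |s|` instead of its square root.
    have h5 : τ (x * p) = τ (star (p : R) * (x * p)) := by
      rw [hpstar', hτ.map_mul_comm (p : R), mul_assoc, hpmul']
    have h6 : l2Norm τ (p : R) ^ 2 = unitMeasure.real s := by
      have h7 := hπ.trace_mul hτ p p
      rw [← Complex.ofReal_inj, ← hτ.trace_star_mul_self, hpstar', h7]
      have h8 : ∫ t, π p t * π p t ∂unitMeasure = ∫ t in s, (1 : ℂ) ∂unitMeasure := by
        rw [← integral_indicator hs]
        refine integral_congr_ae ?_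
        filter_upwards [hp] with t h1
        rw [h1]
        by_cases ht : t ∈ s <;> simp [ht]
      rw [h8, setIntegral_const, Complex.real_smul, mul_one]
    rw [← h4, h5, ← h6]
    refine (hτ.norm_trace_le _ _).trans ?_
    calc l2Norm τ (p : R) * l2Norm τ (x * p)
        ≤ l2Norm τ (p : R) * (‖x‖ * l2Norm τ (p : R)) :=
          mul_le_mul_of_nonneg_left (hτ.l2Norm_mul_le _ _) (l2Norm_nonneg _)
      _ = ‖x‖ * l2Norm τ (p : R) ^ 2 := by ring
  have hginf : MemLp (fun t => star (g t)) ∞ unitMeasure :=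
    memLp_top_of_bound hgL2.1 _ hbound
  refine ⟨π.symm hginf.toLp, SetLike.coe_mem _, fun a ha => ?_⟩
  rw [hπ.trace_mul hτ _ ⟨a, ha⟩, hg ⟨a, ha⟩, LinearEquiv.apply_symm_apply]
  refine integral_congr_ae ?_
  filter_upwards [hginf.coeFn_toLp] with t h1
  rw [h1]

/-- The family of unitaries of `A` corresponding to the exponentials `exp(2πikt)`. -/
theorem exists_unitary (hπ : IsL2IsometricStarIso τ A π) (hτ : IsNormalizedTrace τ) :
    ∃ u : unitary R, (u : R) ∈ A ∧ ∀ j k : ℤ,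
      τ (star ((u ^ j : unitary R) : R) * ((u ^ k : unitary R) : R)) = if j = k then 1 else 0 := by
  have hmem : ∀ k : ℤ, MemLp (fun t : ℝ => Complex.exp (2 * Real.pi * Complex.I * k * t)) ∞
      unitMeasure := fun k => by
    refine memLp_top_of_bound (by fun_prop) 1 (Eventually.of_forall fun t => ?_)
    rw [Complex.norm_exp]
    simp
  let e : ℤ → A := fun k => π.symm (hmem k).toLp
  have he : ∀ k, π (e k) =ᵐ[unitMeasure] fun t : ℝ =>
      Complex.exp (2 * Real.pi * Complex.I * k * t) := fun k => by
    rw [LinearEquiv.apply_symm_apply]; exact (hmem k).coeFn_toLp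
  have he0 : e 0 = 1 := eq_of_ae_eq (π := π) <| by
    filter_upwards [he 0, hπ.map_one] with t h1 h2
    simp [h1, h2]
  have hadd : ∀ j k, e (j + k) = e j * e k := fun j k => eq_of_ae_eq (π := π) <| by
    filter_upwards [he j, he k, he (j + k), hπ.map_mul (e j) (e k)] with t h1 h2 h3 h4
    rw [h4, h1, h2, h3, ← Complex.exp_add]
    push_cast
    ring_nf
  have hstar : ∀ k, star (e k) = e (-k) := fun k => eq_of_ae_eq (π := π) <| by
    filter_upwards [he k, he (-k), hπ.map_star (e k)] with t h1 h2 h3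
    rw [h3, h1, h2, Complex.star_def, ← Complex.exp_conj]
    simp [Complex.conj_ofNat]
  have htrace : ∀ k, k ≠ 0 → τ (e k : R) = 0 := fun k hk => by
    have h1 := hπ.trace_mul hτ 1 (e k)
    rw [OneMemClass.coe_one, one_mul] at h1
    have hc : (2 * Real.pi * Complex.I * k : ℂ) ≠ 0 :=
      mul_ne_zero Complex.two_pi_I_ne_zero (Int.cast_ne_zero.2 hk)
    have h2 : ∫ t, π 1 t * π (e k) t ∂unitMeasure =
        ∫ t in (0 : ℝ)..1, Complex.exp (2 * Real.pi * Complex.I * k * t) := by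
      rw [intervalIntegral.integral_of_le zero_le_one, ← integral_Icc_eq_integral_Ioc]
      refine integral_congr_ae ?_
      filter_upwards [hπ.map_one, he k] with t h3 h4
      rw [h3, h4, one_mul]
    rw [h1, h2, integral_exp_mul_complex hc]
    have h5 := Complex.exp_int_mul_two_pi_mul_I k
    rw [mul_comm] at h5
    simp [h5]
  -- As a homomorphism, `φ` identifies the integer powers of `e 1` with the `e k`, including
  -- negative `k`.
  let φ : Multiplicative ℤ →* unitary R :=
    { toFun := fun k => ⟨e k.toAdd, by
        rw [Unitary.mem_iff]
        constructor
        · rw [← StarMemClass.coe_star, ← MulMemClass.coe_mul, hstar, ← hadd, neg_add_cancel, he0]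
          rfl
        · rw [← StarMemClass.coe_star, ← MulMemClass.coe_mul, hstar, ← hadd, add_neg_cancel, he0]
          rfl⟩
      map_one' := Subtype.ext (congrArg (fun a : A => (a : R)) he0)
      map_mul' := fun j k => Subtype.ext (congrArg (fun a : A => (a : R)) (hadd j.toAdd k.toAdd)) }
  have hφ : ∀ k : ℤ, ((φ (Multiplicative.ofAdd 1) ^ k : unitary R) : R) = e k := fun k => by
    rw [← map_zpow, ← ofAdd_zsmul, zsmul_one]
    rfl
  refine ⟨φ (Multiplicative.ofAdd 1), SetLike.coe_mem (e 1), fun j k => ?_⟩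
  rw [hφ, hφ, ← StarMemClass.coe_star, ← MulMemClass.coe_mul, hstar, ← hadd]
  split_ifs with hjk
  · rw [hjk, neg_add_cancel, he0]
    exact hτ.map_one
  · exact htrace _ (by omega)

theorem isAsymptoticHomomorphism (hπ : IsL2IsometricStarIso τ A π) (hτ : IsNormalizedTrace τ)
    (hA : IsAbelian A) {v : ℕ → R} (hv : IsL2OrthonormalBasis τ A v)
    {Y : Set R} (hY : HasL2DenseSpan τ ⊤ Y)
    (hsum : ∀ x ∈ Y, ∀ y ∈ Y, Summable fun n : ℕ => l2Norm τ (multDefect τ A x y (v n)) ^ 2) :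
    IsAsymptoticHomomorphism τ A := by
  have hE := hπ.hasTraceCondExp hτ
  obtain ⟨u, hu, horth⟩ := hπ.exists_unitary hτ
  refine isAsymptoticHomomorphism_of_hasL2DenseSpan hτ hE hY hu fun x hx y hy => ?_
  let w : ℕ → A := fun n => ⟨v n, hv.mem n⟩
  let c : ℤ → A := fun k => ⟨_, coe_zpow_mem hu k⟩
  let T : R → R → A → A := fun x y a => ⟨_, multDefect_mem hE x y a.2⟩
  have hw : Orthonormal ℂ fun n => toL2 π (w n) := by
    rw [orthonormal_iff_ite]
    intro i j
    rw [hπ.inner_toL2 hτ]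
    exact hv.orthonormal i j
  have hc : Orthonormal ℂ fun k => toL2 π (c k) := by
    rw [orthonormal_iff_ite]
    intro i j
    rw [hπ.inner_toL2 hτ]
    exact horth i j
  have hspan : ⊤ ≤ (Submodule.span ℂ (Set.range fun n => toL2 π (w n))).topologicalClosure := by
    intro f _
    refine denseRange_toL2 (π := π).induction_on f (Submodule.isClosed_topologicalClosure _)
      fun a => ?_
    refine Metric.mem_closure_iff.2 fun ε hε => ?_
    obtain ⟨z, hz, haz⟩ := hv.dense a a.2 ε hε
    have hz' : ∃ b ∈ Submodule.span ℂ (Set.range w), (b : R) = z := by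
      have h1 : Submodule.span ℂ (Set.range v) =
          (Submodule.span ℂ (Set.range w)).map A.toSubmodule.subtype := by
        rw [Submodule.map_span, ← Set.range_comp]
        rfl
      rw [h1] at hz
      exact hz
    obtain ⟨b, hb, rfl⟩ := hz'
    refine ⟨toL2 π b, ?_, ?_⟩
    · have h2 := Submodule.mem_map_of_mem (f := toL2 π) hb
      rwa [Submodule.map_span, ← Set.range_comp] at h2
    · rw [dist_eq_norm, ← map_sub, hπ.norm_toL2]
      exact haz
  have hadj : ∀ a b : A, inner ℂ (toL2 π a) (toL2 π (T x y b)) =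
      inner ℂ (toL2 π (T (star x) (star y) a)) (toL2 π b) := fun a b => by
    rw [hπ.inner_toL2 hτ, hπ.inner_toL2 hτ]
    exact trace_star_mul_multDefect hτ hE hA x y a.2 b.2
  -- Square summability passes from `(v n)` to `(u^k)`; terms of a summable family tend to zero
  -- along `cofinite`.
  have hs := summable_norm_sq_of_hilbertBasis hadj (HilbertBasis.mk hw hspan)
    (v := w) (fun n => by rw [HilbertBasis.coe_mk]) hc
    (by simpa only [hπ.norm_toL2] using hsum x hx y hy)
  have hlim := hs.tendsto_cofinite_zero
  simp only [hπ.norm_toL2] at hlim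
  have hsqrt := hlim.sqrt
  simpa only [Real.sqrt_sq (l2Norm_nonneg _), Real.sqrt_zero] using hsqrt

end IsL2IsometricStarIso

end Isomorphism

end VNMasa

/-- A von Neumann algebra is a C⋆-algebra. -/
noncomputable abbrev VonNeumannAlgebra.cstarAlgebra {H : Type*} [NormedAddCommGroup H]
    [InnerProductSpace ℂ H] [CompleteSpace H] (M : VonNeumannAlgebra H) :
    CStarAlgebra M.toStarSubalgebra :=
  -- `M` is its own bicommutant, and centralizers are norm closed.
  haveI : IsClosed (M.toStarSubalgebra : Set (H →L[ℂ] H)) := by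
    rw [VonNeumannAlgebra.coe_toStarSubalgebra, ← M.centralizer_centralizer]
    exact Set.isClosed_centralizer _
  StarSubalgebra.cstarAlgebra M.toStarSubalgebra

theorem theorem3p1 {H : Type*} [NormedAddCommGroup H] [InnerProductSpace ℂ H] [CompleteSpace H]
    (M : VonNeumannAlgebra H) (hM : VNMasa.IsTypeIIOneFactor M)
    (τ : M.toStarSubalgebra →ₗ[ℂ] ℂ) (hτ : VNMasa.IsNormalizedTrace τ)
    (A : StarSubalgebra ℂ M.toStarSubalgebra) (hA : VNMasa.IsVonNeumannSubalgebra M A)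
    (hAab : VNMasa.IsAbelian A)
    (π : A ≃ₗ[ℂ] Lp ℂ ∞ (volume.restrict (Set.Icc (0 : ℝ) 1)))
    (hπ : VNMasa.IsL2IsometricStarIso τ A π)
    (v : ℕ → M.toStarSubalgebra) (hv : VNMasa.IsL2OrthonormalBasis τ A v)
    (Y : Set M.toStarSubalgebra) (hY : VNMasa.HasL2DenseSpan τ ⊤ Y)
    (hsum : ∀ x ∈ Y, ∀ y ∈ Y, Summable fun n : ℕ =>
      VNMasa.l2Norm τ (VNMasa.traceCondExp τ A (x * v n * y)
        - VNMasa.traceCondExp τ A x * VNMasa.traceCondExp τ A y * v n) ^ 2) :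
    VNMasa.IsAsymptoticHomomorphism τ A ∧ VNMasa.IsStronglySingularMasa τ A ∧
      VNMasa.popaDelta τ A = 1 := by
  let _ : CStarAlgebra M.toStarSubalgebra := M.cstarAlgebra
  have hE := hπ.hasTraceCondExp hτ
  have h := hπ.isAsymptoticHomomorphism hτ hAab hv hY hsum
  exact ⟨h, h.isStronglySingularMasa hτ hE hAab, h.popaDelta_eq_one hτ hE hAab⟩
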